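/- Let $M,N\ge 1$ be integers. A family $\Phi=\{\varphi_i\}_{i=1}^M\subset\mathbb R^N$, also viewed as the $N\times M$ matrix with columns $\varphi_i$, is a frame if there are $0<A\le B<\infty$ with $A\|x\|^2\le\sum_i|\langle x,\varphi_i\rangle|^2\le B\|x\|^2$ for all $x\in\mathbb R^N$; it is tight if one can take $A=B$. A frame is scalable if there are scalars $s_i\ge 0$ such that $\{s_i\varphi_i\}_{i=1}^M$ is a tight frame, and $\mathcal{SC}(M,N)$ denotes the set of scalable frames of $M$ vectors in $\mathbb R^N$. Let $\Phi=\{\varphi_i\}_{i=1}^M$ be a frame for $\mathbb R^N$ with $\|\varphi_i\|_2=1$ for all $i$, and put $$d_\Phi=\inf_{\Psi\in\mathcal{SC}(M,N)}\|\Phi-\Psi\|_F,\qquad D_\Phi=\min_{C\ge 0\ \text{diagonal}}\|\Phi C\Phi^T-I\|_F,\qquad V_\Phi=\frac{\operatorname{Vol}(E_\Phi)}{\omega_N},$$ where $\|\cdot\|_F$ is the Frobenius norm, $E_\Phi$ is the ellipsoid of minimal volume containing the convex hull of $\{\pm\varphi_i\}_{i=1}^M$, and $\omega_N$ is the volume of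 the unit ball of $\mathbb R^N$. If $d_\Phi<1$, then with $K=\min\{M,\tfrac{N(N+1)}2\}$ and $\omega=D_\Phi+\sqrt K$ we have $$\frac{D_\Phi}{\omega+\sqrt{\omega^2-D_\Phi^2}}\le d_\Phi\le\sqrt{KN\left(1-V_\Phi^{2/N}\right)}.$$ Consequently, $d_\Phi$ is bounded below and above by expressions of $D_\Phi$ alone and by expressions of $V_\Phi$ alone: if moreover $D_\Phi<1$, then $$d_\Phi\le\sqrt{KN\left(1-\sqrt{\frac{N(1-D_\Phi^2)}{N-D_\Phi^2}}\right)},$$ and if $N\ge 2$, then with $\delta=\sqrt{\dfrac{N(1-V_\Phi^{4/N})}{N-V_\Phi^{4/N}}}$, $$\frac{\delta}{(\delta+\sqrt K)+\sqrt{(\delta+\sqrt K)^2-\delta^2}}\le d_\Phi.$$ -/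

import Mathlib

namespace ScalableFrame

open MeasureTheory

/-- The family `φ` of `M` vectors is a frame for `ℝ^N`. -/
def IsFrame {M N : ℕ} (φ : Fin M → EuclideanSpace ℝ (Fin N)) : Prop :=
  ∃ A B : ℝ, 0 < A ∧ 0 < B ∧ ∀ x : EuclideanSpace ℝ (Fin N),
    A * ‖x‖ ^ 2 ≤ ∑ i, (inner ℝ x (φ i)) ^ 2 ∧ ∑ i, (inner ℝ x (φ i)) ^ 2 ≤ B * ‖x‖ ^ 2

/-- A frame whose two frame bounds can be chosen equal. -/
def IsTightFrame {M N : ℕ} (φ : Fin M → EuclideanSpace ℝ (Fin N)) : Prop :=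
  ∃ A : ℝ, 0 < A ∧ ∀ x : EuclideanSpace ℝ (Fin N),
    ∑ i, (inner ℝ x (φ i)) ^ 2 = A * ‖x‖ ^ 2

/-- A frame is scalable if its vectors can be rescaled by nonnegative scalars
to form a tight frame. -/
def IsScalable {M N : ℕ} (φ : Fin M → EuclideanSpace ℝ (Fin N)) : Prop :=
  IsFrame φ ∧ ∃ s : Fin M → ℝ, (∀ i, 0 ≤ s i) ∧ IsTightFrame (fun i => s i • φ i)

/-- A frame all of whose vectors have Euclidean norm one. -/
def IsUnitNormFrame {M N : ℕ} (φ : Fin M → EuclideanSpace ℝ (Fin N)) : Prop :=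
  IsFrame φ ∧ ∀ i, ‖φ i‖ = 1

/-- The `N × M` matrix whose `i`-th column is `φ i`. -/
def frameMatrix {M N : ℕ} (φ : Fin M → EuclideanSpace ℝ (Fin N)) :
    Matrix (Fin N) (Fin M) ℝ :=
  Matrix.of fun j i => φ i j

section Frobenius

open scoped Matrix.Norms.Frobenius

/-- The Frobenius distance of `φ` to the set of scalable frames of `M` vectors in `ℝ^N`. -/
noncomputable def distScalable {M N : ℕ} (φ : Fin M → EuclideanSpace ℝ (Fin N)) : ℝ :=
  ⨅ ψ : {ψ : Fin M → EuclideanSpace ℝ (Fin N) // IsScalable ψ},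
    ‖frameMatrix φ - frameMatrix ψ.1‖

/-- The Frobenius distance of the identity matrix to the cone of all `Φ C Φᵀ` with `C` diagonal
and nonnegative. -/
noncomputable def distCone {M N : ℕ} (φ : Fin M → EuclideanSpace ℝ (Fin N)) : ℝ :=
  ⨅ c : {c : Fin M → ℝ // ∀ i, 0 ≤ c i},
    ‖frameMatrix φ * Matrix.diagonal c.1 * (frameMatrix φ).transpose - 1‖

end Frobenius

/-- The set `{v | ⟨X (v - c), v - c⟩ ≤ 1}`; it is an ellipsoid with center `c` when `X` is
positive definite. -/
def ellipsoid {N : ℕ} (X : Matrix (Fin N) (Fin N) ℝ) (c : EuclideanSpace ℝ (Fin N)) :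
    Set (EuclideanSpace ℝ (Fin N)) :=
  {v | inner ℝ (X.toEuclideanLin (v - c)) (v - c) ≤ 1}

/-- The symmetrized frame `{φ i} ∪ {-φ i}`. -/
def symmetrized {M N : ℕ} (φ : Fin M → EuclideanSpace ℝ (Fin N)) :
    Set (EuclideanSpace ℝ (Fin N)) :=
  Set.range φ ∪ Set.range (fun i => -φ i)

/-- The volume of the ellipsoid of minimal volume that contains `K`: the least volume of an
ellipsoid (with any center) containing `K`. -/
noncomputable def minEllipsoidVolume {N : ℕ} (K : Set (EuclideanSpace ℝ (Fin N))) : ℝ :=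
  sInf {v : ℝ | ∃ (X : Matrix (Fin N) (Fin N) ℝ) (c : EuclideanSpace ℝ (Fin N)),
    X.PosDef ∧ K ⊆ ellipsoid X c ∧ v = volume.real (ellipsoid X c)}

/-- The volume of the minimal ellipsoid of the convex hull of the symmetrized frame, divided by
the volume of the unit ball. -/
noncomputable def volumeRatio {M N : ℕ} (φ : Fin M → EuclideanSpace ℝ (Fin N)) : ℝ :=
  minEllipsoidVolume (convexHull ℝ (symmetrized φ)) /
    volume.real (Metric.closedBall (0 : EuclideanSpace ℝ (Fin N)) 1)

end ScalableFrame

/-! Everything is read off from frame operators `Φ C Φᵀ`, and three comparisons carry the result.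
Volume: let `S` maximise the determinant among nonnegative weights of sum `N`. First-order
optimality gives `φᵢᵀ S⁻¹ φᵢ ≤ 1`, so `S⁻¹` defines an enclosing ellipsoid. AM-GM on eigenvalues
shows that no other is smaller, whence `V = √det S`. For the upper bound, put `Q = √S` and `α = tr Q
/ N`: the vectors `α Q⁻¹ φᵢ` form a scalable frame, each within `‖Q - α‖` of `φᵢ`, and AM-GM bounds
this by `V`. Conical Carathéodory leaves at most `K` vectors to move (`exists_isScalable_near`).
Cone: if `Ψ C Ψᵀ = 1` with at most `K` nonzero weights, the weights `cᵢ‖ψᵢ‖²` on `φ` miss the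
identity by at most `√(2K) ‖Φ - Ψ‖`. Thus `D ≤ √(2K) d`, which is stronger than the stated fraction
(`distCone_le_of_isScalable`). Link between `D` and `V`: with `v = V^(4/N)`, `N (1 - v) ≤ D² (N -
v)` (`mul_one_sub_le_norm_sq_mul`). A matrix `Φ C Φᵀ` close to the identity has a determinant
bounded below by a scalar inequality on its eigenvalues, while `det S` is maximal. -/

namespace ScalableFrame

/-! ### Lower bound for a product with prescribed first and second power sums. -/

section ScalarInequalities

/-- Differentiate along `u ↦ u w`: since `-x / (1 - u x) = -x - u x² / (1 - u x)` and every `w i ≤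
s`, replacing `1 - u w i` by `1 - u s` in the quadratic term makes the derivative of the difference
nonnegative on `[0, 1]`. -/
theorem log_one_sub_add_sub_le_sum_log {ι : Type*} [Fintype ι] (w : ι → ℝ) {s : ℝ} (hs0 : 0 ≤ s)
    (hs1 : s < 1) (hw : ∑ i, w i = s ^ 2) (hw2 : ∑ i, w i ^ 2 = s ^ 2) :
    Real.log (1 - s) + s - s ^ 2 ≤ ∑ i, Real.log (1 - w i) := by
  have hle : ∀ i, w i ≤ s := fun i => by
    have h := Finset.single_le_sum (f := fun i => w i ^ 2) (fun j _ => sq_nonneg (w j))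
      (Finset.mem_univ i)
    simp only [hw2] at h
    exact (abs_le_of_sq_le_sq' h hs0).2
  have hpos : ∀ u ∈ Set.Icc (0 : ℝ) 1, ∀ x ≤ s, 0 < 1 - u * x := fun u hu x hx => by
    nlinarith [hu.1, hu.2, mul_le_mul_of_nonneg_left hx hu.1]
  let G : ℝ → ℝ := fun u => ∑ i, Real.log (1 - u * w i) - Real.log (1 - u * s) - u * s + u * s ^ 2
  let G' : ℝ → ℝ := fun u => ∑ i, -w i / (1 - u * w i) - -s / (1 - u * s) - s + s ^ 2
  have hlog : ∀ u ∈ Set.Icc (0 : ℝ) 1, ∀ x ≤ s,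
      HasDerivAt (fun u : ℝ => Real.log (1 - u * x)) (-x / (1 - u * x)) u := fun u hu x hx => by
    have h1 : HasDerivAt (fun u : ℝ => 1 - u * x) (-x) u := by
      simpa using ((hasDerivAt_id u).mul_const x).const_sub 1
    exact h1.log (hpos u hu x hx).ne'
  have hG : ∀ u ∈ Set.Icc (0 : ℝ) 1, HasDerivAt G (G' u) u := fun u hu => by
    have h1 : HasDerivAt (fun u : ℝ => ∑ i, Real.log (1 - u * w i))
        (∑ i, -w i / (1 - u * w i)) u := by
      simpa using HasDerivAt.fun_sum (u := Finset.univ) fun i _ => hlog u hu (w i) (hle i)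
    have h2 : HasDerivAt (fun u : ℝ => u * s) s u := by
      simpa using (hasDerivAt_id u).mul_const s
    have h3 : HasDerivAt (fun u : ℝ => u * s ^ 2) (s ^ 2) u := by
      simpa using (hasDerivAt_id u).mul_const (s ^ 2)
    exact ((h1.sub (hlog u hu s le_rfl)).sub h2).add h3
  have hG' : ∀ u ∈ Set.Icc (0 : ℝ) 1, 0 ≤ G' u := fun u hu => by
    have hd := hpos u hu s le_rfl
    have h1 : ∑ i, (-w i - u / (1 - u * s) * w i ^ 2) ≤ ∑ i, -w i / (1 - u * w i) := by
      refine Finset.sum_le_sum fun i _ => ?_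
      have hi := hpos u hu (w i) (hle i)
      have e1 : -w i / (1 - u * w i) = -w i - u / (1 - u * w i) * w i ^ 2 := by
        rw [div_mul_eq_mul_div, eq_sub_iff_add_eq, ← add_div, div_eq_iff hi.ne']; ring
      rw [e1]
      have : u / (1 - u * w i) ≤ u / (1 - u * s) :=
        div_le_div_of_nonneg_left hu.1 hd (by nlinarith [mul_le_mul_of_nonneg_left (hle i) hu.1])
      nlinarith [mul_le_mul_of_nonneg_right this (sq_nonneg (w i))]
    rw [Finset.sum_sub_distrib, Finset.sum_neg_distrib, ← Finset.mul_sum, hw, hw2] at h1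
    have e2 : -s / (1 - u * s) = -s - u / (1 - u * s) * s ^ 2 := by
      rw [div_mul_eq_mul_div, eq_sub_iff_add_eq, ← add_div, div_eq_iff hd.ne']; ring
    simp only [G', e2]
    linarith
  have hmono : MonotoneOn G (Set.Icc 0 1) := by
    refine monotoneOn_of_deriv_nonneg (convex_Icc 0 1)
      (fun u hu => (hG u hu).continuousAt.continuousWithinAt) (fun u hu => ?_) (fun u hu => ?_)
    · rw [interior_Icc] at hu
      exact (hG u (Set.Ioo_subset_Icc_self hu)).differentiableAt.differentiableWithinAt
    · rw [interior_Icc] at hu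
      rw [(hG u (Set.Ioo_subset_Icc_self hu)).deriv]
      exact hG' u (Set.Ioo_subset_Icc_self hu)
  have := hmono (Set.left_mem_Icc.2 zero_le_one) (Set.right_mem_Icc.2 zero_le_one) zero_le_one
  simp only [G, zero_mul, sub_zero, Real.log_one, one_mul, Finset.sum_const_zero, add_zero] at this
  linarith

/-- The difference of the two sides is `F`, with `F 0 = 0` and `F' = 2x(1 - x + x²) / (1 - x²) ≥ 0`.
-/
theorem three_mul_log_one_sub_sq_sub_le {s : ℝ} (hs0 : 0 ≤ s) (hs1 : s < 1) :
    3 * Real.log (1 - s ^ 2) - s ^ 2 ≤ 2 * (Real.log (1 - s) + s - s ^ 2) := by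
  let F : ℝ → ℝ := fun x => 2 * x - x ^ 2 - Real.log (1 - x) - 3 * Real.log (1 + x)
  have hF : ∀ x ∈ Set.Ico (0 : ℝ) 1,
      HasDerivAt F (2 - 2 * x - -1 / (1 - x) - 3 * (1 / (1 + x))) x := fun x hx => by
    have h1 : HasDerivAt (fun x : ℝ => Real.log (1 - x)) (-1 / (1 - x)) x :=
      ((hasDerivAt_id x).const_sub 1).log (by simpa using (sub_pos.2 hx.2).ne')
    have h2 : HasDerivAt (fun x : ℝ => Real.log (1 + x)) (1 / (1 + x)) x :=
      ((hasDerivAt_id x).const_add 1).log (by have := hx.1; simp; linarith)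
    have h3 : HasDerivAt (fun x : ℝ => 2 * x) 2 x := by simpa using (hasDerivAt_id x).const_mul 2
    have h4 : HasDerivAt (fun x : ℝ => x ^ 2) (2 * x) x := by simpa using hasDerivAt_pow 2 x
    exact ((h3.sub h4).sub h1).sub (h2.const_mul 3)
  have hmono : MonotoneOn F (Set.Ico 0 1) := by
    refine monotoneOn_of_deriv_nonneg (convex_Ico 0 1)
      (fun u hu => (hF u hu).continuousAt.continuousWithinAt) (fun u hu => ?_) (fun u hu => ?_)
    · rw [interior_Ico] at hu
      exact (hF u (Set.Ioo_subset_Ico_self hu)).differentiableAt.differentiableWithinAt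
    · rw [interior_Ico] at hu
      rw [(hF u (Set.Ioo_subset_Ico_self hu)).deriv]
      have h1 : 0 < 1 - u := sub_pos.2 hu.2
      have h2 : 0 < 1 + u := by linarith [hu.1]
      have : 2 - 2 * u - -1 / (1 - u) - 3 * (1 / (1 + u))
          = 2 * u * (1 - u + u ^ 2) / ((1 - u) * (1 + u)) := by field_simp; ring
      rw [this]
      have := hu.1
      have : 0 < 1 - u + u ^ 2 := by positivity
      positivity
  have := hmono (Set.left_mem_Ico.2 zero_lt_one) ⟨hs0, hs1⟩ hs0
  simp only [F] at this
  rw [show 1 - s ^ 2 = (1 - s) * (1 + s) by ring, Real.log_mul (by linarith) (by linarith)]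
  norm_num at this
  linarith

/-- Bounds a determinant through eigenvalues `t` whose sum and sum of squares agree. The deviations
`1 - t i` then have sum and square sum both equal to `r`. -/
theorem pow_le_prod_sq_of_sum_eq_sum_sq {N : ℕ} (hN : 1 ≤ N) (t : Fin N → ℝ) {r : ℝ} (hr1 : r < 1)
    (h1 : ∑ i, t i = N - r) (h2 : ∑ i, t i ^ 2 = N - r) :
    ((1 - r) * (1 - r / N)) ^ N ≤ (∏ i, t i) ^ 2 := by
  have hw : ∑ i, (1 - t i) = r := by simp [Finset.sum_sub_distrib, h1]
  have hw2 : ∑ i, (1 - t i) ^ 2 = r := by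
    have : ∀ i, (1 - t i) ^ 2 = 1 - 2 * t i + t i ^ 2 := fun i => by ring
    simp [this, Finset.sum_sub_distrib, Finset.sum_add_distrib, ← Finset.mul_sum, h1, h2]
    ring
  have hr0 : 0 ≤ r := hw2 ▸ Finset.sum_nonneg fun i _ => sq_nonneg _
  -- For `N = 1, 2` the power sums determine the product and equality holds. The logarithmic
  -- estimate needs `N ≥ 3`, to pass from `3 log (1 - r)` to `N log (1 - r)`.
  obtain rfl | rfl | hN3 : N = 1 ∨ N = 2 ∨ 3 ≤ N := by omega
  · simp at h1 h2 ⊢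
    rw [h1]; apply le_of_eq; ring
  · simp [Fin.sum_univ_two, Fin.prod_univ_two] at h1 h2 ⊢
    have : t 0 * t 1 = (1 - r) * (1 - r / 2) := by
      have : (t 0 + t 1) ^ 2 = (2 - r) ^ 2 := by rw [h1]
      nlinarith
    rw [this]
  · set s := √r
    have hsr : s ^ 2 = r := Real.sq_sqrt hr0
    have hs0 : 0 ≤ s := Real.sqrt_nonneg r
    have hs1 : s < 1 := by rw [Real.sqrt_lt' one_pos]; simpa using hr1
    have hA := log_one_sub_add_sub_le_sum_log (fun i => 1 - t i) hs0 hs1 (hsr ▸ hw) (hsr ▸ hw2)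
    have hB := three_mul_log_one_sub_sq_sub_le hs0 hs1
    simp only [sub_sub_cancel] at hA
    have ht : ∀ i, 0 < t i := fun i => by
      have h := Finset.single_le_sum (f := fun i => (1 - t i) ^ 2) (fun j _ => sq_nonneg _)
        (Finset.mem_univ i)
      simp only [hw2] at h
      nlinarith
    have hNr : (3 : ℝ) ≤ N := by exact_mod_cast hN3
    have hrN : 0 < 1 - r / N := by
      rw [sub_pos, div_lt_one (by linarith)]; linarith
    have h1r : 0 < 1 - r := by linarith
    rw [← Real.log_le_log_iff (by positivity)
      (by have := Finset.prod_pos fun i (_ : i ∈ Finset.univ) => ht i; positivity),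
      Real.log_pow, Real.log_pow, Real.log_mul h1r.ne' hrN.ne',
      Real.log_prod fun i _ => (ht i).ne']
    have hl1 : Real.log (1 - r) ≤ 0 := Real.log_nonpos h1r.le (by linarith)
    have hl2 : (N : ℝ) * Real.log (1 - r / N) ≤ -r := by
      have := Real.log_le_sub_one_of_pos hrN
      have h := mul_le_mul_of_nonneg_left this (by positivity : (0 : ℝ) ≤ N)
      have e : (N : ℝ) * (1 - r / N - 1) = -r := by field_simp; ring
      linarith
    rw [hsr] at hB hA
    push_cast
    nlinarith [mul_nonneg (sub_nonneg.2 hNr) (neg_nonneg.2 hl1)]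

end ScalarInequalities

/-! ### Conical Carathéodory reduction. -/

section Caratheodory

/-- Conical Carathéodory theorem, for a finite family in a finite-dimensional space. -/
theorem exists_nonneg_card_support_le_finrank {ι E : Type*} [Fintype ι] [AddCommGroup E]
    [Module ℝ E] [FiniteDimensional ℝ E] (w : ι → E) (c : ι → ℝ) (hc : ∀ i, 0 ≤ c i) :
    ∃ c' : ι → ℝ, (∀ i, 0 ≤ c' i) ∧ ∑ i, c' i • w i = ∑ i, c i • w i ∧
      (Finset.univ.filter fun i => c' i ≠ 0).card ≤ Module.finrank ℝ E := by
  classical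
  induction h : (Finset.univ.filter fun i => c i ≠ 0).card using Nat.strong_induction_on
    generalizing c with
  | _ n ih =>
  by_cases hn : n ≤ Module.finrank ℝ E
  · exact ⟨c, hc, rfl, h ▸ hn⟩
  push Not at hn
  set s := Finset.univ.filter fun i => c i ≠ 0 with hs
  have hdep : ¬ LinearIndependent ℝ (fun i : s => w i) := fun hli => by
    have := hli.fintype_card_le_finrank
    simp at this
    omega
  rw [Fintype.not_linearIndependent_iff] at hdep
  obtain ⟨g₀, hg₀, j₀, hj₀⟩ := hdep
  obtain ⟨g, hg, j, hj⟩ : ∃ g : s → ℝ, ∑ i, g i • w i = 0 ∧ ∃ j, 0 < g j := by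
    rcases lt_or_gt_of_ne hj₀ with h0 | h0
    · exact ⟨-g₀, by simpa only [Pi.neg_apply, neg_smul, Finset.sum_neg_distrib, neg_eq_zero], j₀, by simpa using h0⟩
    · exact ⟨g₀, hg₀, j₀, h0⟩
  let f : ι → ℝ := fun i => if hi : i ∈ s then g ⟨i, hi⟩ else 0
  have hf0 : ∀ i ∉ s, f i = 0 := fun i hi => by simp [f, hi]
  have hfsum : ∑ i, f i • w i = 0 := by
    rw [← hg, ← Finset.sum_subset (Finset.subset_univ s)
      (fun i _ hi => by simp [hf0 i hi]), ← Finset.sum_coe_sort s]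
    exact Finset.sum_congr rfl fun i _ => by simp [f]
  -- The smallest ratio `c / f` is the largest multiple of the relation that can be subtracted with
  -- weights staying nonnegative; it kills the weight at `k`.
  obtain ⟨k, hk, hmin⟩ := Finset.exists_min_image (Finset.univ.filter fun i => 0 < f i)
    (fun i => c i / f i) ⟨j, by simpa [f] using hj⟩
  have hfk : 0 < f k := (Finset.mem_filter.1 hk).2
  let c₁ : ι → ℝ := fun i => c i - c k / f k * f i
  have hc₁ : ∀ i, 0 ≤ c₁ i := fun i => by
    by_cases hi : 0 < f i
    · have := hmin i (by simpa using hi)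
      rw [le_div_iff₀ hi] at this
      simpa [c₁] using this
    · have h1 : 0 ≤ c k / f k := div_nonneg (hc k) hfk.le
      have := mul_nonneg h1 (neg_nonneg.2 (not_lt.1 hi))
      have := hc i
      simp only [c₁]; linarith
  have hsum : ∑ i, c₁ i • w i = ∑ i, c i • w i := by
    simp only [c₁, sub_smul, Finset.sum_sub_distrib, mul_smul, ← Finset.smul_sum, hfsum, smul_zero,
      sub_zero]
  have hks : k ∈ s := by
    by_contra hks
    exact hfk.ne' (hf0 k hks)
  have hlt : (Finset.univ.filter fun i => c₁ i ≠ 0).card < n := by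
    rw [← h]
    refine Finset.card_lt_card (Finset.ssubset_iff_subset_ne.2 ⟨fun i hi => ?_, fun he => ?_⟩)
    · by_contra his
      have h1 : c i = 0 := by simpa [hs] using his
      exact (Finset.mem_filter.1 hi).2 (by simp [c₁, h1, hf0 i his])
    · rw [← he] at hks
      exact (Finset.mem_filter.1 hks).2 (by simp [c₁, hfk.ne'])
  obtain ⟨c', h1, h2, h3⟩ := ih _ hlt c₁ hc₁ rfl
  exact ⟨c', h1, h2.trans hsum, h3⟩

end Caratheodory

/-! ### Eigenvalue identities and AM-GM for determinants. -/

section Matrices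

open Matrix

variable {n : Type*} [Fintype n] [DecidableEq n]

theorem trace_sq_eq_sum_eigenvalues_sq {A : Matrix n n ℝ} (hA : A.IsHermitian) :
    (A * A).trace = ∑ i, hA.eigenvalues i ^ 2 := by
  conv_lhs => rw [hA.spectral_theorem, ← map_mul, Unitary.conjStarAlgAut_apply, trace_mul_cycle,
    Unitary.coe_star_mul_self, one_mul, diagonal_mul_diagonal, trace_diagonal]
  simp [sq]

theorem det_le_trace_div_card_pow [Nonempty n] {A : Matrix n n ℝ} (hA : A.PosSemidef) :
    A.det ≤ (A.trace / Fintype.card n) ^ Fintype.card n := by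
  have hc : (0 : ℝ) < Fintype.card n := by exact_mod_cast Fintype.card_pos
  have hprod : 0 ≤ ∏ i, hA.1.eigenvalues i :=
    Finset.prod_nonneg fun i _ => hA.eigenvalues_nonneg i
  rw [hA.1.det_eq_prod_eigenvalues, hA.1.trace_eq_sum_eigenvalues]
  have h := Real.geom_mean_le_arith_mean Finset.univ (fun _ => 1) hA.1.eigenvalues
    (fun _ _ => zero_le_one) (by simpa using hc) fun i _ => hA.eigenvalues_nonneg i
  simp only [Real.rpow_one, one_mul, Finset.sum_const, Finset.card_univ, nsmul_eq_mul,
    mul_one] at h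
  calc ∏ i, hA.1.eigenvalues i
      = ((∏ i, hA.1.eigenvalues i) ^ (Fintype.card n : ℝ)⁻¹) ^ Fintype.card n :=
        (Real.rpow_inv_natCast_pow hprod Fintype.card_ne_zero).symm
    _ ≤ _ := pow_le_pow_left₀ (Real.rpow_nonneg hprod _) h _

end Matrices

open Matrix

variable {M N : ℕ}

/-! ### Weighted frame operators and determinant maximisation. -/

section FrameOperator

/-- The matrix `Φ C Φᵀ` with `C` the diagonal matrix of the weights `c`. -/
def weightedFrameOp (φ : Fin M → EuclideanSpace ℝ (Fin N)) (c : Fin M → ℝ) :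
    Matrix (Fin N) (Fin N) ℝ :=
  frameMatrix φ * diagonal c * (frameMatrix φ)ᵀ

theorem weightedFrameOp_apply (φ : Fin M → EuclideanSpace ℝ (Fin N)) (c : Fin M → ℝ)
    (a b : Fin N) : weightedFrameOp φ c a b = ∑ i, c i * (φ i a * φ i b) := by
  rw [weightedFrameOp, mul_apply]
  simp only [mul_diagonal, transpose_apply, frameMatrix, of_apply]
  exact Finset.sum_congr rfl fun i _ => by ring

theorem inner_eq_dotProduct (x y : EuclideanSpace ℝ (Fin N)) :
    inner ℝ x y = x.ofLp ⬝ᵥ y.ofLp := by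
  rw [EuclideanSpace.inner_eq_star_dotProduct, dotProduct_comm]; rfl

theorem dotProduct_self_eq_norm_sq (x : EuclideanSpace ℝ (Fin N)) :
    x.ofLp ⬝ᵥ x.ofLp = ‖x‖ ^ 2 := by
  rw [← inner_eq_dotProduct, real_inner_self_eq_norm_sq]

theorem trace_mul_weightedFrameOp (X : Matrix (Fin N) (Fin N) ℝ)
    (φ : Fin M → EuclideanSpace ℝ (Fin N)) (c : Fin M → ℝ) :
    (X * weightedFrameOp φ c).trace = ∑ i, c i * ((φ i).ofLp ⬝ᵥ X *ᵥ (φ i).ofLp) := by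
  simp only [trace, diag_apply, mul_apply, weightedFrameOp_apply, dotProduct, mulVec,
    Finset.mul_sum]
  rw [Finset.sum_comm_cycle]
  refine Finset.sum_congr rfl fun i _ => ?_
  exact Finset.sum_congr rfl fun a _ => Finset.sum_congr rfl fun b _ => by ring

theorem trace_weightedFrameOp {φ : Fin M → EuclideanSpace ℝ (Fin N)} (hφ : ∀ i, ‖φ i‖ = 1)
    (c : Fin M → ℝ) : (weightedFrameOp φ c).trace = ∑ i, c i := by
  simpa [dotProduct_self_eq_norm_sq, hφ] using trace_mul_weightedFrameOp 1 φ c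

theorem dotProduct_weightedFrameOp_mulVec (φ : Fin M → EuclideanSpace ℝ (Fin N))
    (c : Fin M → ℝ) (x : EuclideanSpace ℝ (Fin N)) :
    x.ofLp ⬝ᵥ weightedFrameOp φ c *ᵥ x.ofLp = ∑ i, c i * (inner ℝ x (φ i)) ^ 2 := by
  simp only [weightedFrameOp_apply, dotProduct, mulVec, inner_eq_dotProduct, Finset.mul_sum,
    Finset.sum_mul, sq]
  rw [Finset.sum_comm_cycle]
  exact Finset.sum_congr rfl fun i _ => Finset.sum_congr rfl fun a _ =>
    Finset.sum_congr rfl fun b _ => by ring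

theorem weightedFrameOp_posSemidef (φ : Fin M → EuclideanSpace ℝ (Fin N)) {c : Fin M → ℝ}
    (hc : ∀ i, 0 ≤ c i) : (weightedFrameOp φ c).PosSemidef := by
  simpa [weightedFrameOp, conjTranspose_eq_transpose_of_trivial] using
    (PosSemidef.diagonal (d := c) hc).mul_mul_conjTranspose_same (frameMatrix φ)

theorem weightedFrameOp_smul (φ : Fin M → EuclideanSpace ℝ (Fin N)) (c : Fin M → ℝ) (t : ℝ) :
    weightedFrameOp φ (t • c) = t • weightedFrameOp φ c := by
  ext a b
  simp [weightedFrameOp_apply, Finset.mul_sum, mul_assoc]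

theorem weightedFrameOp_add_single (φ : Fin M → EuclideanSpace ℝ (Fin N)) (c : Fin M → ℝ)
    (i : Fin M) (t : ℝ) :
    weightedFrameOp φ (c + Pi.single i t) = weightedFrameOp φ c +
      replicateCol Unit (t • (φ i).ofLp) * replicateRow Unit (φ i).ofLp := by
  ext a b
  simp [weightedFrameOp_apply, add_mul, Finset.sum_add_distrib, Pi.single_apply, mul_apply]

theorem continuous_det_weightedFrameOp (φ : Fin M → EuclideanSpace ℝ (Fin N)) :
    Continuous fun c => (weightedFrameOp φ c).det := by
  refine Continuous.matrix_det ?_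
  unfold weightedFrameOp
  fun_prop

theorem IsFrame.posDef_weightedFrameOp_one {φ : Fin M → EuclideanSpace ℝ (Fin N)}
    (hφ : IsFrame φ) : (weightedFrameOp φ 1).PosDef := by
  obtain ⟨A, B, hA, -, hAB⟩ := hφ
  refine PosDef.of_dotProduct_mulVec_pos
    (weightedFrameOp_posSemidef φ fun _ => zero_le_one).1 fun x hx => ?_
  have h := dotProduct_weightedFrameOp_mulVec φ 1 (WithLp.toLp 2 x)
  simp only [Pi.one_apply, one_mul] at h
  rw [star_trivial, h]
  refine lt_of_lt_of_le ?_ (hAB _).1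
  have : 0 < ‖WithLp.toLp 2 x‖ := by simpa using hx
  positivity

/-- The weights whose frame operator has maximal determinant: its inverse defines an ellipsoid
that contains the frame. -/
theorem IsFrame.exists_isMaxOn_det {φ : Fin M → EuclideanSpace ℝ (Fin N)} (hφ : IsFrame φ)
    (hN : 1 ≤ N) : ∃ c : Fin M → ℝ, (∀ i, 0 ≤ c i) ∧ ∑ i, c i = N ∧
      (weightedFrameOp φ c).PosDef ∧
      (∀ i, (φ i).ofLp ⬝ᵥ (weightedFrameOp φ c)⁻¹ *ᵥ (φ i).ofLp ≤ 1) ∧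
      ∀ c' : Fin M → ℝ, (∀ i, 0 ≤ c' i) → ∑ i, c' i = N →
        (weightedFrameOp φ c').det ≤ (weightedFrameOp φ c).det := by
  have hN0 : (0 : ℝ) < N := by exact_mod_cast hN
  have hone := hφ.posDef_weightedFrameOp_one
  have hM : 0 < M := by
    rcases Nat.eq_zero_or_pos M with rfl | h
    · have h0 : weightedFrameOp φ 1 = 0 := by ext a b; simp [weightedFrameOp_apply]
      have : Nonempty (Fin N) := ⟨⟨0, hN⟩⟩
      have := hone.det_pos
      simp [h0] at this
    · exact h
  have hM0 : (0 : ℝ) < M := by exact_mod_cast hM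
  have hne : (stdSimplex ℝ (Fin M)).Nonempty := ⟨_, single_mem_stdSimplex ℝ ⟨0, hM⟩⟩
  obtain ⟨p, hp, hmax⟩ := (isCompact_stdSimplex ℝ (Fin M)).exists_isMaxOn hne
    ((continuous_det_weightedFrameOp φ).comp (continuous_const_smul (N : ℝ))).continuousOn
  set c : Fin M → ℝ := (N : ℝ) • p
  have hc : ∀ i, 0 ≤ c i := fun i => mul_nonneg hN0.le (hp.1 i)
  have hcN : ∑ i, c i = N := by simp [c, ← Finset.mul_sum, hp.2]
  have hcmax : ∀ c' : Fin M → ℝ, (∀ i, 0 ≤ c' i) → ∑ i, c' i = N →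
      (weightedFrameOp φ c').det ≤ (weightedFrameOp φ c).det := fun c' h0 h1 => by
    have := hmax (show (N : ℝ)⁻¹ • c' ∈ stdSimplex ℝ (Fin M) from
      ⟨fun i => mul_nonneg (by positivity) (h0 i), by
        simp [← Finset.mul_sum, h1, hN0.ne']⟩)
    simpa [smul_smul, hN0.ne'] using this
  have hdet : 0 < (weightedFrameOp φ c).det := by
    refine lt_of_lt_of_le ?_ (hcmax (((N : ℝ) / M) • 1) (fun i => by simp; positivity)
      (by simp; field_simp))
    rw [weightedFrameOp_smul, det_smul]
    have := hone.det_pos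
    positivity
  have hpd : (weightedFrameOp φ c).PosDef :=
    (weightedFrameOp_posSemidef φ hc).posDef_iff_det_ne_zero.2 hdet.ne'
  refine ⟨c, hc, hcN, hpd, fun i => ?_, hcmax⟩
  set S := weightedFrameOp φ c
  set g := (φ i).ofLp ⬝ᵥ S⁻¹ *ᵥ (φ i).ofLp
  have hrank : ∀ u : ℝ, (weightedFrameOp φ (c + Pi.single i u)).det = S.det * (1 + u * g) :=
    fun u => by
    rw [weightedFrameOp_add_single, det_add_replicateCol_mul_replicateRow hdet.ne'.isUnit]
    congr 1
    rw [Matrix.mul_assoc, ← replicateCol_mulVec, det_unique, Matrix.add_apply, one_apply_eq,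
      replicateRow_mul_replicateCol_apply, mulVec_smul, dotProduct_smul, smul_eq_mul]
  -- Add weight `u` at `i`, rescale the total back to `N`, and compare determinants. Both sides
  -- agree at `u = 0`, so the right derivative there forces `g ≤ 1`.
  have hineq : ∀ u : ℝ, 0 ≤ u → N ^ N * (1 + u * g) ≤ (N + u) ^ N := fun u hu => by
    have hNu : 0 < N + u := by positivity
    have h := hcmax (((N : ℝ) / (N + u)) • (c + Pi.single i u))
      (fun j => by
        have : 0 ≤ (Pi.single i u : Fin M → ℝ) j := by
          rw [Pi.single_apply]; split_ifs <;> simp [hu]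
        exact mul_nonneg (by positivity) (add_nonneg (hc j) this))
      (by
        simp [← Finset.mul_sum, Finset.sum_add_distrib, hcN]; field_simp)
    rw [weightedFrameOp_smul, det_smul, hrank, Fintype.card_fin, div_pow, div_mul_eq_mul_div,
      div_le_iff₀ (by positivity)] at h
    have h' : S.det * (N ^ N * (1 + u * g)) ≤ S.det * (N + u) ^ N := by linarith
    exact le_of_mul_le_mul_left h' hdet
  by_contra! hg
  have hd : HasDerivAt (fun u : ℝ => (N + u) ^ N - N ^ N * (1 + u * g))
      (N * (N + 0) ^ (N - 1) * 1 - N ^ N * g) 0 := by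
    have h1 : HasDerivAt (fun u : ℝ => N + u) 1 0 := (hasDerivAt_id 0).const_add _
    have h2 : HasDerivAt (fun u : ℝ => 1 + u * g) g 0 := by
      simpa using ((hasDerivAt_id (0 : ℝ)).mul_const g).const_add 1
    exact (h1.fun_pow N).sub (h2.const_mul _)
  have hneg : (N * (N + 0) ^ (N - 1) * 1 - N ^ N * g : ℝ) < 0 := by
    rw [add_zero, mul_one, mul_pow_sub_one (by omega)]
    nlinarith [pow_pos hN0 N]
  obtain ⟨u, hu, hu'⟩ := ((hd.hasDerivWithinAt (s := Set.Ioi 0)).limsup_slope_le' (by simp) hneg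
    |>.and self_mem_nhdsWithin).exists
  rw [slope_def_field] at hu
  have := hineq u (le_of_lt hu')
  rw [div_lt_iff₀ (by linarith)] at hu
  simp at hu
  linarith

end FrameOperator

open MeasureTheory

/-! ### Ellipsoid volumes and the minimal ellipsoid. -/

section Volume

open scoped MatrixOrder in
theorem exists_posDef_mul_self_eq {n : Type*} [Fintype n] [DecidableEq n] {A : Matrix n n ℝ}
    (hA : A.PosDef) : ∃ Q : Matrix n n ℝ, Q.PosDef ∧ Q * Q = A := by
  have h : CFC.sqrt A * CFC.sqrt A = A := CFC.sqrt_mul_sqrt_self A hA.posSemidef.nonneg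
  refine ⟨CFC.sqrt A, (CFC.sqrt_nonneg A).posSemidef.posDef_iff_det_ne_zero.2 fun h0 => ?_, h⟩
  have := hA.det_pos
  rw [← h, det_mul, h0] at this
  simp at this

theorem inner_toEuclideanLin (X : Matrix (Fin N) (Fin N) ℝ) (x : EuclideanSpace ℝ (Fin N)) :
    inner ℝ (X.toEuclideanLin x) x = x.ofLp ⬝ᵥ X *ᵥ x.ofLp := by
  rw [inner_eq_dotProduct, dotProduct_comm]; rfl

theorem norm_sq_toEuclideanLin {Q : Matrix (Fin N) (Fin N) ℝ} (hQ : Q.PosDef)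
    (x : EuclideanSpace ℝ (Fin N)) :
    ‖Q.toEuclideanLin x‖ ^ 2 = x.ofLp ⬝ᵥ (Q * Q) *ᵥ x.ofLp := by
  have hT : Qᵀ = Q := by simpa [conjTranspose_eq_transpose_of_trivial] using hQ.1.eq
  rw [← dotProduct_self_eq_norm_sq, ← mulVec_mulVec, dotProduct_mulVec x.ofLp, ← mulVec_transpose,
    hT]
  rfl

theorem ellipsoid_mul_self_eq_preimage {Q : Matrix (Fin N) (Fin N) ℝ} (hQ : Q.PosDef)
    (c : EuclideanSpace ℝ (Fin N)) : ellipsoid (Q * Q) c =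
      (fun v => v + -c) ⁻¹' (Q.toEuclideanLin ⁻¹' Metric.closedBall 0 1) := by
  ext v
  rw [ellipsoid, Set.mem_ofPred_eq, inner_toEuclideanLin, ← norm_sq_toEuclideanLin hQ]
  simp [sub_eq_add_neg]

theorem volume_ellipsoid {X : Matrix (Fin N) (Fin N) ℝ} (hX : X.PosDef)
    (c : EuclideanSpace ℝ (Fin N)) :
    volume.real (ellipsoid X c) =
      (√X.det)⁻¹ * volume.real (Metric.closedBall (0 : EuclideanSpace ℝ (Fin N)) 1) := by
  obtain ⟨Q, hQ, rfl⟩ := exists_posDef_mul_self_eq hX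
  have hdet : LinearMap.det Q.toEuclideanLin = Q.det := by
    rw [toEuclideanLin_eq_toLin_orthonormal, LinearMap.det_toLin]
  have h0 : LinearMap.det Q.toEuclideanLin ≠ 0 := hdet ▸ hQ.det_pos.ne'
  rw [ellipsoid_mul_self_eq_preimage hQ, measureReal_def, measure_preimage_add_right,
    Measure.addHaar_preimage_linearMap _ h0,
    ENNReal.toReal_mul, ENNReal.toReal_ofReal (abs_nonneg _), hdet, det_mul,
    Real.sqrt_mul_self hQ.det_pos.le, abs_of_pos (inv_pos.2 hQ.det_pos), measureReal_def]

theorem convex_ellipsoid {X : Matrix (Fin N) (Fin N) ℝ} (hX : X.PosDef)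
    (c : EuclideanSpace ℝ (Fin N)) : Convex ℝ (ellipsoid X c) := by
  obtain ⟨Q, hQ, rfl⟩ := exists_posDef_mul_self_eq hX
  rw [ellipsoid_mul_self_eq_preimage hQ]
  exact ((convex_closedBall 0 1).linear_preimage _).translate_preimage_left _

/-- The weights act as a dual certificate: for a competitor `X = Q²`, `tr (Q S Q) = ∑ cᵢ φᵢᵀ X φᵢ ≤
N`, so AM-GM gives `det X * det S ≤ 1`. -/
theorem volumeRatio_eq_sqrt_det {φ : Fin M → EuclideanSpace ℝ (Fin N)} (hN : 1 ≤ N)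
    {c : Fin M → ℝ} (hc : ∀ i, 0 ≤ c i) (hcN : ∑ i, c i = N)
    (hS : (weightedFrameOp φ c).PosDef)
    (hle : ∀ i, (φ i).ofLp ⬝ᵥ (weightedFrameOp φ c)⁻¹ *ᵥ (φ i).ofLp ≤ 1) :
    volumeRatio φ = √(weightedFrameOp φ c).det := by
  set S := weightedFrameOp φ c
  have hball : 0 < volume.real (Metric.closedBall (0 : EuclideanSpace ℝ (Fin N)) 1) :=
    ENNReal.toReal_pos (Metric.measure_closedBall_pos _ _ one_pos).ne'
      measure_closedBall_lt_top.ne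
  have hleast : IsLeast {v : ℝ | ∃ (X : Matrix (Fin N) (Fin N) ℝ) (c : EuclideanSpace ℝ (Fin N)),
      X.PosDef ∧ convexHull ℝ (symmetrized φ) ⊆ ellipsoid X c ∧ v = volume.real (ellipsoid X c)}
      (√S.det * volume.real (Metric.closedBall (0 : EuclideanSpace ℝ (Fin N)) 1)) := by
    constructor
    · refine ⟨S⁻¹, 0, hS.inv, convexHull_min ?_ (convex_ellipsoid hS.inv 0), ?_⟩
      · rintro _ (⟨i, rfl⟩ | ⟨i, rfl⟩)
        · simpa [ellipsoid, inner_toEuclideanLin] using hle i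
        · simpa [ellipsoid, inner_toEuclideanLin, mulVec_neg] using hle i
      · rw [volume_ellipsoid hS.inv, det_nonsing_inv, Ring.inverse_eq_inv', Real.sqrt_inv, inv_inv]
    · rintro _ ⟨X, e, hX, hsub, rfl⟩
      rw [volume_ellipsoid hX]
      refine mul_le_mul_of_nonneg_right ?_ hball.le
      -- Averaging the conditions at `φ i` and `-φ i` cancels the terms linear in the center `e`;
      -- what remains of `e` is nonnegative.
      have hXφ : ∀ i, (φ i).ofLp ⬝ᵥ X *ᵥ (φ i).ofLp ≤ 1 := fun i => by
        have h1 := hsub (subset_convexHull ℝ _ (Or.inl ⟨i, rfl⟩))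
        have h2 := hsub (subset_convexHull ℝ _ (Or.inr ⟨i, rfl⟩))
        have h3 := hX.posSemidef.dotProduct_mulVec_nonneg e.ofLp
        rw [ellipsoid, Set.mem_ofPred_eq, inner_toEuclideanLin] at h1 h2
        simp only [WithLp.ofLp_sub, WithLp.ofLp_neg, mulVec_sub, mulVec_neg, dotProduct_sub,
          sub_dotProduct, neg_dotProduct, dotProduct_neg, star_trivial] at h1 h2 h3
        linarith
      obtain ⟨Q, hQ, rfl⟩ := exists_posDef_mul_self_eq hX
      have hT : Qᴴ = Q := hQ.1.eq
      have hne : Nonempty (Fin N) := ⟨⟨0, hN⟩⟩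
      have hN0 : (0 : ℝ) < N := by exact_mod_cast hN
      have hpsd : (Q * S * Q).PosSemidef := by
        simpa only [hT] using hS.posSemidef.mul_mul_conjTranspose_same Q
      have htr : (Q * S * Q).trace ≤ N := by
        rw [trace_mul_comm, ← Matrix.mul_assoc, trace_mul_weightedFrameOp, ← hcN]
        exact Finset.sum_le_sum fun i _ => mul_le_of_le_one_right (hc i) (hXφ i)
      have hdet : (Q * S * Q).det ≤ 1 := by
        refine (det_le_trace_div_card_pow hpsd).trans (pow_le_one₀ ?_ ?_)
        · exact div_nonneg hpsd.trace_nonneg (by positivity)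
        · rwa [Fintype.card_fin, div_le_one hN0]
      rw [← Real.sqrt_inv]
      refine Real.sqrt_le_sqrt ?_
      rw [det_mul, det_mul] at hdet
      rw [det_mul, ← one_div, le_div_iff₀ (mul_pos hQ.det_pos hQ.det_pos)]
      linarith
  rw [volumeRatio, minEllipsoidVolume, hleast.csInf_eq, mul_div_assoc, div_self hball.ne', mul_one]

end Volume

/-! ### Frobenius norm identities. -/

section FrobeniusNorm

open scoped Matrix.Norms.Frobenius

theorem frobenius_norm_sq {m n : Type*} [Fintype m] [Fintype n] (A : Matrix m n ℝ) :
    ‖A‖ ^ 2 = ∑ i, ∑ j, A i j ^ 2 := by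
  have h : 0 ≤ ∑ i, ∑ j, ‖A i j‖ ^ (2 : ℝ) := by positivity
  rw [frobenius_norm_def, ← Real.sqrt_eq_rpow, Real.sq_sqrt h]
  simp

theorem frobenius_norm_sq_eq_trace {m n : Type*} [Fintype m] [Fintype n] (A : Matrix m n ℝ) :
    ‖A‖ ^ 2 = (Aᵀ * A).trace := by
  rw [frobenius_norm_sq, Finset.sum_comm]
  simp [trace, mul_apply, sq]

theorem frobenius_norm_sub_smul_one_sq {A : Matrix (Fin N) (Fin N) ℝ} (hA : A.IsHermitian)
    (t : ℝ) : ‖A - t • 1‖ ^ 2 = (A * A).trace - 2 * t * A.trace + t ^ 2 * N := by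
  have hT : Aᵀ = A := by simpa [conjTranspose_eq_transpose_of_trivial] using hA.eq
  rw [frobenius_norm_sq_eq_trace]
  simp [hT, sub_mul, mul_sub, trace_sub, trace_smul]
  ring

theorem norm_sq_frameMatrix_sub (φ ψ : Fin M → EuclideanSpace ℝ (Fin N)) :
    ‖frameMatrix φ - frameMatrix ψ‖ ^ 2 = ∑ i, ‖φ i - ψ i‖ ^ 2 := by
  rw [frobenius_norm_sq, Finset.sum_comm]
  exact Finset.sum_congr rfl fun i _ => by simp [EuclideanSpace.norm_sq_eq, frameMatrix]

theorem norm_toEuclideanLin_le (A : Matrix (Fin N) (Fin N) ℝ) (x : EuclideanSpace ℝ (Fin N)) :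
    ‖A.toEuclideanLin x‖ ^ 2 ≤ ‖A‖ ^ 2 * ‖x‖ ^ 2 := by
  rw [frobenius_norm_sq, EuclideanSpace.norm_sq_eq, EuclideanSpace.norm_sq_eq, Finset.sum_mul]
  refine Finset.sum_le_sum fun i _ => ?_
  simpa [mulVec, dotProduct] using Finset.sum_mul_sq_le_sq_mul_sq Finset.univ (A i) x.ofLp

theorem norm_sq_smul_vecMulVec_sub (a b : ℝ) (x y : EuclideanSpace ℝ (Fin N)) :
    ‖a • vecMulVec x.ofLp x.ofLp - b • vecMulVec y.ofLp y.ofLp‖ ^ 2 =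
      a ^ 2 * (‖x‖ ^ 2) ^ 2 - 2 * a * b * (inner ℝ x y) ^ 2 + b ^ 2 * (‖y‖ ^ 2) ^ 2 := by
  have hsq : ∀ f : Fin N → ℝ, (∑ i, f i) ^ 2 = ∑ i, ∑ j, f i * f j := fun f => by
    rw [sq, Finset.sum_mul_sum]
  simp only [frobenius_norm_sq, inner_eq_dotProduct, ← dotProduct_self_eq_norm_sq,
    dotProduct, hsq, Finset.mul_sum, ← Finset.sum_sub_distrib, ← Finset.sum_add_distrib]
  refine Finset.sum_congr rfl fun i _ => Finset.sum_congr rfl fun j _ => ?_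
  simp [vecMulVec_apply]
  ring

theorem weightedFrameOp_eq_sum (φ : Fin M → EuclideanSpace ℝ (Fin N)) (c : Fin M → ℝ) :
    weightedFrameOp φ c = ∑ i, c i • vecMulVec (φ i).ofLp (φ i).ofLp := by
  ext a b
  simp [weightedFrameOp_apply, Matrix.sum_apply, vecMulVec_apply]

end FrobeniusNorm

/-! ### Sparse weights. -/

section Sparse

/-- The frame operator of nonnegative weights can be realised by nonnegative weights with at most
`N * (N + 1) / 2` nonzero entries. -/
theorem exists_sparse_weights (φ : Fin M → EuclideanSpace ℝ (Fin N)) {c : Fin M → ℝ}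
    (hc : ∀ i, 0 ≤ c i) : ∃ c' : Fin M → ℝ, (∀ i, 0 ≤ c' i) ∧
      weightedFrameOp φ c' = weightedFrameOp φ c ∧
      ((Finset.univ.filter fun i => c' i ≠ 0).card : ℝ) ≤
        min (M : ℝ) ((N : ℝ) * ((N : ℝ) + 1) / 2) := by
  -- Symmetric matrices are encoded as functions on unordered index pairs, so that the dimension is
  -- `N(N+1)/2` rather than `N²`.
  obtain ⟨c', h0, h1, h2⟩ := exists_nonneg_card_support_le_finrank
    (fun i (z : Sym2 (Fin N)) => Sym2.mul (z.map (φ i).ofLp)) c hc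
  refine ⟨c', h0, ?_, le_min ?_ ?_⟩
  · ext a b
    simpa [weightedFrameOp_apply] using congrFun h1 s(a, b)
  · exact_mod_cast (Finset.card_le_univ _).trans_eq (Fintype.card_fin M)
  · rw [Module.finrank_fintype_fun_eq_card, Sym2.card, Fintype.card_fin] at h2
    have h3 : ((Finset.univ.filter fun i => c' i ≠ 0).card : ℝ) ≤ ((N + 1).choose 2 : ℕ) := by
      exact_mod_cast h2
    rw [Nat.cast_choose_two] at h3
    push_cast at h3
    linarith

end Sparse

/-! ### Scalability as `Ψ C Ψᵀ = 1`. -/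

section Scalable

theorem weightedFrameOp_eq_one_iff (ψ : Fin M → EuclideanSpace ℝ (Fin N)) {c : Fin M → ℝ}
    (hc : ∀ i, 0 ≤ c i) : weightedFrameOp ψ c = 1 ↔
      ∀ x : EuclideanSpace ℝ (Fin N), ∑ i, c i * (inner ℝ x (ψ i)) ^ 2 = ‖x‖ ^ 2 := by
  constructor
  · intro h x
    rw [← dotProduct_weightedFrameOp_mulVec, h, one_mulVec, dotProduct_self_eq_norm_sq]
  · intro h
    have hq : ∀ x : Fin N → ℝ, x ⬝ᵥ weightedFrameOp ψ c *ᵥ x = x ⬝ᵥ x := fun x => by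
      have := dotProduct_weightedFrameOp_mulVec ψ c (WithLp.toLp 2 x)
      rw [h, ← dotProduct_self_eq_norm_sq] at this
      exact this
    have hS := (weightedFrameOp_posSemidef ψ hc).1
    open scoped MatrixOrder in
    refine le_antisymm ?_ ?_
    · refine PosSemidef.of_dotProduct_mulVec_nonneg (isHermitian_one.sub hS) fun x => ?_
      simp [sub_mulVec, dotProduct_sub, hq]
    · refine PosSemidef.of_dotProduct_mulVec_nonneg (hS.sub isHermitian_one) fun x => ?_
      simp [sub_mulVec, dotProduct_sub, hq]

theorem IsScalable.exists_weightedFrameOp_eq_one {ψ : Fin M → EuclideanSpace ℝ (Fin N)}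
    (hψ : IsScalable ψ) : ∃ c : Fin M → ℝ, (∀ i, 0 ≤ c i) ∧ weightedFrameOp ψ c = 1 := by
  obtain ⟨-, s, -, A, hA, hs⟩ := hψ
  have hc : ∀ i, 0 ≤ s i ^ 2 / A := fun i => by positivity
  refine ⟨fun i => s i ^ 2 / A, hc, (weightedFrameOp_eq_one_iff ψ hc).2 fun x => ?_⟩
  have h := hs x
  simp only [inner_smul_right, mul_pow] at h
  rw [← mul_right_inj' hA.ne', ← h, Finset.mul_sum]
  exact Finset.sum_congr rfl fun i _ => by field_simp

theorem isScalable_of_weightedFrameOp_eq_one {ψ : Fin M → EuclideanSpace ℝ (Fin N)}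
    {c : Fin M → ℝ} (hc : ∀ i, 0 ≤ c i) (h : weightedFrameOp ψ c = 1) : IsScalable ψ := by
  rw [weightedFrameOp_eq_one_iff ψ hc] at h
  have hsum : 0 ≤ ∑ i, c i := Finset.sum_nonneg fun i _ => hc i
  refine ⟨⟨(1 + ∑ i, c i)⁻¹, 1 + ∑ i, ‖ψ i‖ ^ 2, by positivity, by positivity, fun x => ⟨?_, ?_⟩⟩,
    fun i => √(c i), fun i => Real.sqrt_nonneg _, 1, one_pos, fun x => ?_⟩
  · rw [inv_mul_le_iff₀ (by positivity), ← h x, Finset.mul_sum]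
    refine Finset.sum_le_sum fun i hi => mul_le_mul_of_nonneg_right ?_ (sq_nonneg _)
    linarith [Finset.single_le_sum (fun j _ => hc j) hi]
  · rw [add_mul, Finset.sum_mul]
    refine le_add_of_nonneg_of_le (by positivity) (Finset.sum_le_sum fun i _ => ?_)
    rw [← mul_pow, mul_comm]
    exact sq_le_sq' (by linarith [neg_le_of_abs_le (abs_real_inner_le_norm x (ψ i))])
      (real_inner_le_norm x (ψ i))
  · simp only [inner_smul_right, mul_pow, Real.sq_sqrt (hc _), one_mul, h x]

end Scalable

/-! ### The three comparisons between `d`, `D` and `V`. -/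

section Bounds

open scoped Matrix.Norms.Frobenius

theorem distCone_le (φ : Fin M → EuclideanSpace ℝ (Fin N)) {c : Fin M → ℝ} (hc : ∀ i, 0 ≤ c i) :
    distCone φ ≤ ‖weightedFrameOp φ c - 1‖ :=
  ciInf_le (f := fun c : {c : Fin M → ℝ // ∀ i, 0 ≤ c i} => ‖weightedFrameOp φ c.1 - 1‖)
    ⟨0, by rintro _ ⟨_, rfl⟩; exact norm_nonneg _⟩ ⟨c, hc⟩

theorem le_distCone {φ : Fin M → EuclideanSpace ℝ (Fin N)} {a : ℝ}
    (h : ∀ c : Fin M → ℝ, (∀ i, 0 ≤ c i) → a ≤ ‖weightedFrameOp φ c - 1‖) : a ≤ distCone φ :=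
  haveI : Nonempty {c : Fin M → ℝ // ∀ i, 0 ≤ c i} := ⟨⟨0, fun _ => le_rfl⟩⟩
  le_ciInf fun c => h c.1 c.2

theorem distScalable_le (φ : Fin M → EuclideanSpace ℝ (Fin N))
    {ψ : Fin M → EuclideanSpace ℝ (Fin N)} (hψ : IsScalable ψ) :
    distScalable φ ≤ ‖frameMatrix φ - frameMatrix ψ‖ :=
  ciInf_le (f := fun ψ : {ψ : Fin M → EuclideanSpace ℝ (Fin N) // IsScalable ψ} =>
    ‖frameMatrix φ - frameMatrix ψ.1‖)
    ⟨0, by rintro _ ⟨_, rfl⟩; exact norm_nonneg _⟩ ⟨ψ, hψ⟩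

theorem distCone_le_of_isScalable {φ ψ : Fin M → EuclideanSpace ℝ (Fin N)}
    (hφ : ∀ i, ‖φ i‖ = 1) (hψ : IsScalable ψ) :
    distCone φ ≤ √(2 * min (M : ℝ) ((N : ℝ) * ((N : ℝ) + 1) / 2)) *
      ‖frameMatrix φ - frameMatrix ψ‖ := by
  obtain ⟨c₀, hc₀, h₀⟩ := hψ.exists_weightedFrameOp_eq_one
  obtain ⟨c, hc, hc1, hcard⟩ := exists_sparse_weights ψ hc₀
  rw [h₀] at hc1
  set s := Finset.univ.filter fun i => c i ≠ 0
  -- Parseval tested at `x = ψ i`, keeping only the `i`-th term.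
  have hbound : ∀ i, c i * ‖ψ i‖ ^ 2 ≤ 1 := fun i => by
    have h := (weightedFrameOp_eq_one_iff ψ hc).1 hc1 (ψ i)
    have h1 := Finset.single_le_sum (f := fun j => c j * (inner ℝ (ψ i) (ψ j)) ^ 2)
      (fun j _ => mul_nonneg (hc j) (sq_nonneg _)) (Finset.mem_univ i)
    simp only [h, real_inner_self_eq_norm_sq] at h1
    by_contra! h2
    rcases (sq_nonneg ‖ψ i‖).eq_or_lt with h3 | h3
    · rw [← h3] at h2; linarith
    · nlinarith
  -- The weight `c i * ‖ψ i‖²` matches the traces of the two rank-one terms, as `φ i` is a unit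
  -- vector. The slack is the square in `e`.
  have hterm : ∀ i, ‖(c i * ‖ψ i‖ ^ 2) • vecMulVec (φ i).ofLp (φ i).ofLp -
      c i • vecMulVec (ψ i).ofLp (ψ i).ofLp‖ ≤ √2 * ‖φ i - ψ i‖ := fun i => by
    refine abs_le_of_sq_le_sq' ?_ (by positivity) |>.2
    rw [norm_sq_smul_vecMulVec_sub, hφ, mul_pow √2, Real.sq_sqrt zero_le_two, norm_sub_sq_real, hφ]
    set b := c i * ‖ψ i‖ ^ 2 with hb
    set x := inner ℝ (φ i) (ψ i)
    set p := ‖ψ i‖ ^ 2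
    have hp : 0 ≤ p := sq_nonneg _
    have hb0 : 0 ≤ b := mul_nonneg (hc i) hp
    have hq : 0 ≤ 1 - 2 * x + p := by
      have := sq_nonneg ‖φ i - ψ i‖
      rw [norm_sub_sq_real, hφ] at this
      simpa using this
    have h1 : b ^ 2 * (1 - 2 * x + p) ≤ 1 - 2 * x + p :=
      mul_le_of_le_one_left hq (pow_le_one₀ hb0 (hbound i))
    have e : b ^ 2 * (1 - 2 * x + p) - (b ^ 2 - b * c i * x ^ 2) = c i ^ 2 * (p - x) ^ 2 * p := by
      rw [hb]; ring
    have h3 : 0 ≤ c i ^ 2 * (p - x) ^ 2 * p := by positivity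
    have e2 : c i ^ 2 * p ^ 2 = b ^ 2 := by rw [hb]; ring
    rw [e2]
    linarith
  have hzero : ∀ i ∉ s, ‖(c i * ‖ψ i‖ ^ 2) • vecMulVec (φ i).ofLp (φ i).ofLp -
      c i • vecMulVec (ψ i).ofLp (ψ i).ofLp‖ = 0 := fun i hi => by
    have : c i = 0 := by simpa [s] using hi
    simp [this]
  calc distCone φ
      ≤ ‖weightedFrameOp φ (fun i => c i * ‖ψ i‖ ^ 2) - 1‖ :=
        distCone_le φ fun i => mul_nonneg (hc i) (sq_nonneg _)
    _ ≤ ∑ i, ‖(c i * ‖ψ i‖ ^ 2) • vecMulVec (φ i).ofLp (φ i).ofLp -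
          c i • vecMulVec (ψ i).ofLp (ψ i).ofLp‖ := by
        rw [← hc1, weightedFrameOp_eq_sum, weightedFrameOp_eq_sum, ← Finset.sum_sub_distrib]
        exact norm_sum_le _ _
    _ = ∑ i ∈ s, ‖(c i * ‖ψ i‖ ^ 2) • vecMulVec (φ i).ofLp (φ i).ofLp -
          c i • vecMulVec (ψ i).ofLp (ψ i).ofLp‖ :=
        (Finset.sum_subset (Finset.subset_univ s) fun i _ hi => hzero i hi).symm
    _ ≤ ∑ i ∈ s, √2 * ‖φ i - ψ i‖ := Finset.sum_le_sum fun i _ => hterm i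
    _ ≤ _ := by
        refine abs_le_of_sq_le_sq' ?_ (by positivity) |>.2
        rw [← Finset.mul_sum, mul_pow, mul_pow, Real.sq_sqrt zero_le_two, norm_sq_frameMatrix_sub,
          Real.sq_sqrt (by positivity), mul_assoc]
        refine mul_le_mul_of_nonneg_left ?_ zero_le_two
        refine sq_sum_le_card_mul_sum_sq.trans ?_
        exact mul_le_mul hcard (Finset.sum_le_univ_sum_of_nonneg fun i => sq_nonneg _)
          (by positivity) (by positivity)

theorem exists_isScalable_near {φ : Fin M → EuclideanSpace ℝ (Fin N)} (hN : 1 ≤ N)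
    {c : Fin M → ℝ} (hc : ∀ i, 0 ≤ c i) (hS : (weightedFrameOp φ c).PosDef)
    (htr : (weightedFrameOp φ c).trace = N)
    (hle : ∀ i, (φ i).ofLp ⬝ᵥ (weightedFrameOp φ c)⁻¹ *ᵥ (φ i).ofLp ≤ 1) :
    ∃ ψ : Fin M → EuclideanSpace ℝ (Fin N), IsScalable ψ ∧
      ‖frameMatrix φ - frameMatrix ψ‖ ^ 2 ≤ min (M : ℝ) ((N : ℝ) * ((N : ℝ) + 1) / 2) * N *
        (1 - √(weightedFrameOp φ c).det ^ (2 / (N : ℝ))) := by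
  have hne : Nonempty (Fin N) := ⟨⟨0, hN⟩⟩
  have hN0 : (0 : ℝ) < N := by exact_mod_cast hN
  obtain ⟨c', hc', hcS, hcard⟩ := exists_sparse_weights φ hc
  rw [← hcS] at hS htr hle ⊢
  obtain ⟨Q, hQ, hQS⟩ := exists_posDef_mul_self_eq hS
  have hQu : IsUnit Q.det := hQ.det_pos.ne'.isUnit
  have hQT : Qᵀ = Q := by simpa [conjTranspose_eq_transpose_of_trivial] using hQ.1.eq
  set α := Q.trace / N with hα
  have hαpos : 0 < α := div_pos hQ.trace_pos hN0
  have hvol : √(weightedFrameOp φ c').det ^ (2 / (N : ℝ)) ≤ α ^ 2 := by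
    have h1 : Q.det ≤ α ^ N := by
      simpa using det_le_trace_div_card_pow hQ.posSemidef
    rw [← hQS, det_mul, Real.sqrt_mul_self hQ.det_pos.le]
    calc Q.det ^ (2 / (N : ℝ)) ≤ (α ^ N) ^ (2 / (N : ℝ)) :=
          Real.rpow_le_rpow hQ.det_pos.le h1 (by positivity)
      _ = α ^ 2 := by
          rw [← Real.rpow_natCast, ← Real.rpow_mul hαpos.le, mul_div_cancel₀ _ hN0.ne']
          norm_cast
  -- Uses `tr Q² = tr S = N`.
  have hnorm : ‖Q - α • 1‖ ^ 2 = N * (1 - α ^ 2) := by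
    rw [frobenius_norm_sub_smul_one_sq hQ.1, hQS, htr,
      show Q.trace = N * α by rw [hα]; field_simp]
    ring
  let L : EuclideanSpace ℝ (Fin N) → EuclideanSpace ℝ (Fin N) := fun x =>
    α • Q⁻¹.toEuclideanLin x
  have hL : ∀ i, ‖φ i - L (φ i)‖ ^ 2 ≤ N * (1 - α ^ 2) := fun i => by
    set u := Q⁻¹.toEuclideanLin (φ i) with hu
    have h1 : φ i - L (φ i) = (Q - α • 1).toEuclideanLin u := by
      ext j
      simp [L, ← hu]
      simp [hu, mulVec_mulVec, mul_nonsing_inv Q hQu]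
    have h2 : ‖u‖ ^ 2 ≤ 1 := by
      rw [hu, norm_sq_toEuclideanLin hQ.inv, ← Matrix.mul_inv_rev, hQS]
      exact hle i
    rw [h1, ← hnorm]
    exact (norm_toEuclideanLin_le _ _).trans (mul_le_of_le_one_right (sq_nonneg _) h2)
  -- Vectors of zero weight do not affect the frame operator and stay put, so only the sparse
  -- support contributes to the distance.
  let ψ : Fin M → EuclideanSpace ℝ (Fin N) := fun i => if c' i = 0 then φ i else L (φ i)
  have hψ : weightedFrameOp ψ ((α⁻¹ ^ 2) • c') = 1 := by
    have h1 : weightedFrameOp ψ c' = weightedFrameOp (fun i => L (φ i)) c' := by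
      ext a b
      simp only [weightedFrameOp_apply]
      refine Finset.sum_congr rfl fun i _ => ?_
      by_cases h : c' i = 0 <;> simp [ψ, h]
    have h2 : frameMatrix (fun i => L (φ i)) = α • (Q⁻¹ * frameMatrix φ) := by
      ext a i
      simp [frameMatrix, L, mul_apply, mulVec, dotProduct]
    have h3 : weightedFrameOp (fun i => L (φ i)) c' =
        α ^ 2 • (Q⁻¹ * weightedFrameOp φ c' * Q⁻¹) := by
      rw [weightedFrameOp, h2, weightedFrameOp]
      simp [transpose_mul, transpose_nonsing_inv, hQT, Matrix.mul_assoc, smul_smul, sq]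
    rw [weightedFrameOp_smul, h1, h3, smul_smul, ← hQS, nonsing_inv_mul_cancel_left _ _ hQu,
      mul_nonsing_inv _ hQu]
    rw [← mul_pow, inv_mul_cancel₀ hαpos.ne', one_pow, one_smul]
  refine ⟨ψ, isScalable_of_weightedFrameOp_eq_one
    (fun i => mul_nonneg (by positivity) (hc' i)) hψ, ?_⟩
  have h0 : 0 ≤ N * (1 - α ^ 2) := hnorm ▸ sq_nonneg _
  rw [norm_sq_frameMatrix_sub]
  calc ∑ i, ‖φ i - ψ i‖ ^ 2
      = ∑ i ∈ Finset.univ.filter fun i => c' i ≠ 0, ‖φ i - ψ i‖ ^ 2 :=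
        (Finset.sum_subset (Finset.subset_univ _) fun i _ hi => by
          have : c' i = 0 := by simpa using hi
          simp [ψ, this]).symm
    _ ≤ ∑ i ∈ Finset.univ.filter fun i => c' i ≠ 0, (N * (1 - α ^ 2) : ℝ) :=
        Finset.sum_le_sum fun i hi => by
          have : c' i ≠ 0 := by simpa using hi
          simpa [ψ, this] using hL i
    _ ≤ min (M : ℝ) ((N : ℝ) * ((N : ℝ) + 1) / 2) * (N * (1 - α ^ 2)) := by
        rw [Finset.sum_const, nsmul_eq_mul]
        exact mul_le_mul_of_nonneg_right hcard h0
    _ ≤ _ := by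
        rw [mul_assoc]
        gcongr

theorem le_mul_sub_of_trace_eq {φ : Fin M → EuclideanSpace ℝ (Fin N)} (hN : 1 ≤ N)
    (hφ : ∀ i, ‖φ i‖ = 1) {d v : ℝ} (hv : 0 ≤ v) (hvd : v ^ N = d ^ 2)
    (hmax : ∀ c' : Fin M → ℝ, (∀ i, 0 ≤ c' i) → ∑ i, c' i = N → (weightedFrameOp φ c').det ≤ d)
    {c : Fin M → ℝ} (hc : ∀ i, 0 ≤ c i) {r : ℝ} (hr : r < 1)
    (h1 : (weightedFrameOp φ c).trace = N - r)
    (h2 : (weightedFrameOp φ c * weightedFrameOp φ c).trace = N - r) :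
    N * (1 - r) ≤ v * (N - r) := by
  have hN1 : (1 : ℝ) ≤ N := by exact_mod_cast hN
  have hNr : 0 < N - r := by linarith
  have hT := weightedFrameOp_posSemidef φ hc
  have hs := pow_le_prod_sq_of_sum_eq_sum_sq hN hT.1.eigenvalues hr
    (by rw [← h1, hT.1.trace_eq_sum_eigenvalues]; rfl)
    (by rw [← h2, trace_sq_eq_sum_eigenvalues_sq hT.1])
  have hdet : (weightedFrameOp φ c).det = ∏ i, hT.1.eigenvalues i :=
    hT.1.det_eq_prod_eigenvalues
  rw [← hdet] at hs
  -- Restores trace `N`, as the maximality of `d` requires.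
  have hm := hmax ((N / (N - r)) • c) (fun i => mul_nonneg (by positivity) (hc i)) (by
    simp only [Pi.smul_apply, smul_eq_mul, ← Finset.mul_sum]
    rw [← trace_weightedFrameOp hφ, h1, div_mul_cancel₀ _ hNr.ne'])
  rw [weightedFrameOp_smul, det_smul, Fintype.card_fin] at hm
  have hm2 : ((N / (N - r)) ^ N * (weightedFrameOp φ c).det) ^ 2 ≤ d ^ 2 :=
    pow_le_pow_left₀ (mul_nonneg (by positivity) hT.det_nonneg) hm 2
  have key : (N * (1 - r) / (N - r)) ^ N ≤ v ^ N := by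
    rw [hvd]
    refine le_trans ?_ hm2
    rw [mul_pow]
    refine le_trans (le_of_eq ?_) (mul_le_mul_of_nonneg_left hs (by positivity))
    rw [← pow_mul, mul_comm N 2, pow_mul, ← mul_pow]
    congr 1
    field_simp
  have := le_of_pow_le_pow_left₀ (by omega) hv key
  rwa [div_le_iff₀ hNr] at this

/-- Replacing `T` by its best multiple only lowers the distance to the identity and equalises the
traces of `T` and `T²`, which reduces to `le_mul_sub_of_trace_eq`. -/
theorem mul_one_sub_le_norm_sq_mul {φ : Fin M → EuclideanSpace ℝ (Fin N)} (hN : 1 ≤ N)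
    (hφ : ∀ i, ‖φ i‖ = 1) {d v : ℝ} (hv : 0 ≤ v) (hv1 : v ≤ 1) (hvd : v ^ N = d ^ 2)
    (hmax : ∀ c' : Fin M → ℝ, (∀ i, 0 ≤ c' i) → ∑ i, c' i = N → (weightedFrameOp φ c').det ≤ d)
    {c : Fin M → ℝ} (hc : ∀ i, 0 ≤ c i) :
    N * (1 - v) ≤ ‖weightedFrameOp φ c - 1‖ ^ 2 * (N - v) := by
  have hN1 : (1 : ℝ) ≤ N := by exact_mod_cast hN
  have hT := weightedFrameOp_posSemidef φ hc
  have hr := frobenius_norm_sub_smul_one_sq hT.1 1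
  rw [one_smul] at hr
  set r := ‖weightedFrameOp φ c - 1‖ ^ 2
  set T := weightedFrameOp φ c
  set τ := T.trace
  set p := (T * T).trace with hp
  rcases le_or_gt 1 r with h1 | h1
  · nlinarith
  have hτ0 : 0 ≤ τ := hT.trace_nonneg
  have hp0 : 0 ≤ p := by
    rw [hp, trace_sq_eq_sum_eigenvalues_sq hT.1]; positivity
  have hτ : 0 < τ := by nlinarith
  have hppos : 0 < p := by
    refine hp0.lt_of_ne fun h => hτ.ne' ?_
    rw [hp, trace_sq_eq_sum_eigenvalues_sq hT.1, eq_comm,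
      Finset.sum_eq_zero_iff_of_nonneg fun i _ => sq_nonneg _] at h
    simp only [τ]
    rw [hT.1.trace_eq_sum_eigenvalues]
    exact Finset.sum_eq_zero fun i hi => by simpa using h i hi
  -- The left side is the minimum of `‖t T - 1‖²` over `t`, attained at `t = τ / p`.
  have hle : N - τ ^ 2 / p ≤ r := by
    have : 0 ≤ (p - τ) ^ 2 / p := by positivity
    have e : (p - τ) ^ 2 / p = p - 2 * τ + τ ^ 2 / p := by field_simp; ring
    linarith
  have h := le_mul_sub_of_trace_eq hN hφ hv hvd hmax (c := (τ / p) • c)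
    (fun i => mul_nonneg (by positivity) (hc i)) (r := N - τ ^ 2 / p) (by linarith)
    (by rw [weightedFrameOp_smul, trace_smul, smul_eq_mul]; simp only [τ, T]; ring)
    (by
      rw [weightedFrameOp_smul, smul_mul_smul_comm, trace_smul, smul_eq_mul]
      change τ / p * (τ / p) * p = _
      field_simp; ring)
  have : 0 ≤ N - v := by linarith
  nlinarith [mul_le_mul_of_nonneg_right hle this]

end Bounds

end ScalableFrame

/-! ### Assembly of the bounds. -/

theorem theorem3p3 (M N : ℕ) (hN : 1 ≤ N) (φ : Fin M → EuclideanSpace ℝ (Fin N))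
    (hφ : ScalableFrame.IsUnitNormFrame φ) (d D V K : ℝ)
    (hd : d = ScalableFrame.distScalable φ)
    (hD : D = ScalableFrame.distCone φ)
    (hV : V = ScalableFrame.volumeRatio φ)
    (hK : K = min (M : ℝ) ((N : ℝ) * ((N : ℝ) + 1) / 2))
    (hd1 : d < 1) :
    -- the two-sided estimate, with `ω = D + √K`
    D / ((D + √K) + √((D + √K) ^ 2 - D ^ 2)) ≤ d ∧
    d ≤ √(K * N * (1 - V ^ (2 / (N : ℝ)))) ∧
    -- consequently: an upper bound in terms of `D` alone
    (D < 1 → d ≤ √(K * N * (1 - √(N * (1 - D ^ 2) / (N - D ^ 2))))) ∧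
    -- consequently: a lower bound in terms of `V` alone
    (2 ≤ N → ∀ δ : ℝ, δ = √(N * (1 - V ^ (4 / (N : ℝ))) / (N - V ^ (4 / (N : ℝ)))) →
      δ / ((δ + √K) + √((δ + √K) ^ 2 - δ ^ 2)) ≤ d) := by
  open ScalableFrame in
  open scoped Matrix.Norms.Frobenius in
  have hN1 : (1 : ℝ) ≤ N := by exact_mod_cast hN
  have hN0 : (0 : ℝ) < N := by linarith
  have hne : Nonempty (Fin N) := ⟨⟨0, hN⟩⟩
  obtain ⟨c, hc, hcN, hS, hle, hmax⟩ := hφ.1.exists_isMaxOn_det hN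
  have htr : (weightedFrameOp φ c).trace = N := by rw [trace_weightedFrameOp hφ.2, hcN]
  have hVS : V = √(weightedFrameOp φ c).det := hV ▸ volumeRatio_eq_sqrt_det hN hc hcN hS hle
  have hdet := hS.det_pos
  have hVpos : 0 < V := hVS ▸ Real.sqrt_pos.2 hdet
  have hVsq : V ^ 2 = (weightedFrameOp φ c).det := by rw [hVS, Real.sq_sqrt hdet.le]
  set v := V ^ (4 / (N : ℝ)) with hv
  have hv0 : 0 ≤ v := Real.rpow_nonneg hVpos.le _
  have hvN : v ^ N = (weightedFrameOp φ c).det ^ 2 := by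
    rw [hv, ← Real.rpow_natCast, ← Real.rpow_mul hVpos.le, div_mul_cancel₀ _ hN0.ne', ← hVsq,
      ← pow_mul]
    norm_cast
  have hvsqrt : V ^ (2 / (N : ℝ)) = √v := by
    rw [hv, Real.sqrt_eq_rpow, ← Real.rpow_mul hVpos.le]
    congr 1; ring
  have hv1 : v ≤ 1 := by
    have h : (weightedFrameOp φ c).det ≤ 1 := by
      simpa [htr, hN0.ne'] using det_le_trace_div_card_pow hS.posSemidef
    rw [← pow_le_one_iff_of_nonneg hv0 (by omega : N ≠ 0), hvN]
    exact pow_le_one₀ hdet.le h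
  obtain ⟨ψ₀, hψ₀, hnear⟩ := exists_isScalable_near hN hc hS htr hle
  rw [← hVS, ← hK, hvsqrt] at hnear
  have hupper : d ≤ √(K * N * (1 - √v)) := by
    rw [hd]
    exact (distScalable_le φ hψ₀).trans (Real.le_sqrt_of_sq_le hnear)
  have hM : 0 < M := by
    rcases Nat.eq_zero_or_pos M with rfl | h
    · simp at hcN; linarith
    · exact h
  have hKpos : 0 < K := by
    rw [hK]
    exact lt_min (by exact_mod_cast hM) (by positivity)
  have hlower : D ≤ √(2 * K) * d := by
    have : Nonempty {ψ : Fin M → EuclideanSpace ℝ (Fin N) // IsScalable ψ} := ⟨⟨ψ₀, hψ₀⟩⟩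
    rw [← div_le_iff₀' (by positivity), hd]
    refine le_ciInf fun ψ => ?_
    rw [div_le_iff₀' (by positivity), hD, hK]
    exact distCone_le_of_isScalable hφ.2 ψ.2
  have hD0 : 0 ≤ D := hD ▸ le_distCone fun c _ => norm_nonneg _
  -- The denominator is at least `2√K ≥ √(2K)`. Allowing any `x ≤ D` covers both `D` and `δ`.
  have hfrac : ∀ x : ℝ, 0 ≤ x → x ≤ D → x / ((x + √K) + √((x + √K) ^ 2 - x ^ 2)) ≤ d := by
    intro x hx hxD
    have hsK : 0 < √K := Real.sqrt_pos.2 hKpos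
    have h1 : √K ≤ √((x + √K) ^ 2 - x ^ 2) := by
      refine Real.sqrt_le_sqrt ?_
      nlinarith [Real.sq_sqrt hKpos.le]
    have h2 : √(2 * K) ≤ 2 * √K := by
      rw [Real.sqrt_le_left (by positivity), mul_pow, Real.sq_sqrt hKpos.le]
      linarith
    have h3 : 0 < √(2 * K) := by positivity
    have hd0 : 0 ≤ d := by
      by_contra! h
      nlinarith
    rw [div_le_iff₀ (by positivity)]
    nlinarith
  have hcone : v < N → √(N * (1 - v) / (N - v)) ≤ D := fun hvlt => by
    have hNv : 0 < N - v := sub_pos.2 hvlt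
    rw [hD]
    refine le_distCone fun c' hc' => ?_
    rw [Real.sqrt_le_left (norm_nonneg _), div_le_iff₀ hNv]
    exact mul_one_sub_le_norm_sq_mul hN hφ.2 hv0 hv1 hvN hmax hc'
  refine ⟨hfrac D hD0 le_rfl, hvsqrt ▸ hupper, fun hD1 => hupper.trans ?_, fun hN2 δ hδ => ?_⟩
  · have hND : 0 < N - D ^ 2 := by nlinarith
    have : N * (1 - D ^ 2) / (N - D ^ 2) ≤ v := by
      rw [div_le_iff₀ hND]
      -- Equality `v = N` forces `N = v = 1`, where the bound is trivial.
      rcases (hv1.trans hN1).lt_or_eq with h | h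
      · have h1 := hcone h
        rw [Real.sqrt_le_left hD0, div_le_iff₀ (sub_pos.2 h)] at h1
        linarith
      · have h1 : v = 1 := le_antisymm hv1 (h ▸ hN1)
        rw [← h, h1]
    gcongr
  · have hN2' : (2 : ℝ) ≤ N := by exact_mod_cast hN2
    exact hfrac δ (hδ ▸ Real.sqrt_nonneg _) (hδ ▸ hcone (by linarith))
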